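/- For a finite group $G$, let $J(G)$ denote the smallest index of a normal abelian subgroup of $G$; for an arbitrary group $\Gamma$ let $J(\Gamma)=\sup\{J(G) : G\subseteq\Gamma \text{ a finite subgroup}\}\in\mathbb{N}\cup\{\infty\}$ be its Jordan constant. Let $K$ be a field of characteristic $0$ such that $\sqrt{5}\in K$ and $-1$ is not a sum of two squares in $K$, and let $L/K$ be a quadratic field extension. Let $\mathrm{PGL}_2(L)\rtimes\mathbb{Z}/2\mathbb{Z}$ be the semidirect product in which the nontrivial element of $\mathbb{Z}/2\mathbb{Z}$ acts on $\mathrm{PGL}_2(L)$ by applying the Galois involution of $L/K$ (the nontrivial $K$-automorphism of $L$) to the entries of matrices. Then $$J\bigl(\mathrm{PGL}_2(L)\rtimes\mathbb{Z}/2\mathbb{Z}\bigr)\leqslant 60.$$ -/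

import Mathlib

open scoped MatrixGroups

/-- The Jordan constant of a finite group `G`: the smallest index of a normal abelian subgroup
of `G`. The set below is nonempty (it contains the index of the trivial subgroup). -/
noncomputable def finiteJordanConstant (G : Type*) [Group G] [Finite G] : ℕ :=
  sInf {n : ℕ | ∃ N : Subgroup G, N.Normal ∧ (∀ x ∈ N, ∀ y ∈ N, x * y = y * x) ∧ N.index = n}

/-- The Jordan constant of an arbitrary group `Γ`: the supremum of the Jordan constants of its
finite subgroups, as an element of `ℕ∞`. The group `Γ` is Jordan iff this value is finite. -/
noncomputable def jordanConstant (Γ : Type*) [Group Γ] : ℕ∞ :=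
  ⨆ (G : Subgroup Γ) (_ : Finite G), (finiteJordanConstant G : ℕ∞)

section QuadraticExtension

variable (K L : Type*) [Field K] [CharZero K] [Field L] [Algebra K L]
  [Algebra.IsQuadraticExtension K L]

theorem card_galois_quadratic : Nat.card (L ≃ₐ[K] L) = 2 := by
  rw [IsGalois.card_aut_eq_finrank, Algebra.IsQuadraticExtension.finrank_eq_two]

theorem existsUnique_galois_ne_one : ∃! σ : L ≃ₐ[K] L, σ ≠ 1 := by
  obtain ⟨y, hy, huniq⟩ := (Nat.card_eq_two_iff' (1 : L ≃ₐ[K] L)).1 (card_galois_quadratic K L)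
  exact ⟨y, hy, huniq⟩

/-- The Galois involution of a quadratic extension `L / K`: the unique nontrivial
`K`-automorphism of `L`. -/
noncomputable def galoisInvolution : L ≃ₐ[K] L :=
  (existsUnique_galois_ne_one K L).choose

theorem galoisInvolution_ne_one : galoisInvolution K L ≠ 1 :=
  (existsUnique_galois_ne_one K L).choose_spec.1

theorem galoisInvolution_apply_apply (x : L) :
    galoisInvolution K L (galoisInvolution K L x) = x := by
  have h : galoisInvolution K L ^ 2 = 1 := by
    rw [← card_galois_quadratic K L]
    exact pow_card_eq_one'
  rw [pow_two] at h
  exact DFunLike.congr_fun h x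

theorem galoisInvolution_comp_self :
    (galoisInvolution K L : L →+* L).comp (galoisInvolution K L : L →+* L) = RingHom.id L :=
  RingHom.ext (galoisInvolution_apply_apply K L)

theorem map_galoisInvolution_comp_self :
    (Matrix.ProjGenLinGroup.map (n := Fin 2) (galoisInvolution K L : L →+* L)).comp
      (Matrix.ProjGenLinGroup.map (galoisInvolution K L : L →+* L)) = MonoidHom.id _ := by
  rw [← Matrix.ProjGenLinGroup.map_comp, galoisInvolution_comp_self,
    Matrix.ProjGenLinGroup.map_id]

/-- The automorphism of `PGL₂(L)` that applies the Galois involution of `L / K` to the matrix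
entries. -/
noncomputable def pglGaloisInvolution : MulAut (PGL(2, L)) :=
  MonoidHom.toMulEquiv
    (Matrix.ProjGenLinGroup.map (galoisInvolution K L : L →+* L))
    (Matrix.ProjGenLinGroup.map (galoisInvolution K L : L →+* L))
    (map_galoisInvolution_comp_self K L) (map_galoisInvolution_comp_self K L)

theorem pglGaloisInvolution_mul_self :
    pglGaloisInvolution K L * pglGaloisInvolution K L = 1 :=
  MulEquiv.ext fun x => DFunLike.congr_fun (map_galoisInvolution_comp_self K L) x

/-- The action of `ℤ/2ℤ` on `PGL₂(L)` in which the nontrivial element acts by the Galois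
involution of `L / K`. -/
noncomputable def pglGaloisAction : Multiplicative (ZMod 2) →* MulAut (PGL(2, L)) where
  toFun i := if i = 1 then 1 else pglGaloisInvolution K L
  map_one' := if_pos rfl
  map_mul' i j := by
    have h2 : ∀ k : Multiplicative (ZMod 2), k = 1 ∨ k = Multiplicative.ofAdd 1 := by decide
    have hne : ¬ (Multiplicative.ofAdd (1 : ZMod 2) = 1) := by decide
    have hmul : Multiplicative.ofAdd (1 : ZMod 2) * Multiplicative.ofAdd 1 = 1 := by decide
    rcases h2 i with rfl | rfl <;> rcases h2 j with rfl | rfl <;>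
      simp only [mul_one, one_mul, if_true, if_neg hne, hmul, pglGaloisInvolution_mul_self]

end QuadraticExtension

/-!
Let `G` be a finite subgroup of `PGL₂(L) ⋊ ℤ/2ℤ` and let `N = G ∩ PGL₂(L)`, a subgroup of index at
most two.

Over an algebraic closure of `L`, every nontrivial element of `N` is diagonalizable and has exactly
two fixed points on the projective line, and the stabilizer in `N` of a point is abelian. Counting
orbits (`exists_index_stabilizer_le_two_or_card_eq`) shows that either `N` has an abelian subgroup
of index at most two or `|N| ∈ {12, 24, 60}`; this is `exists_abelian_index_le_two_or_card_eq`. In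
the first case `G` has an abelian subgroup of index at most four, whose normal core has index at
most `4! = 24`. If `|N| ≤ 24`, or if `G = N`, then `|G| ≤ 60` and the trivial subgroup suffices.

There remains the case `|G| = 120`, in which `G` could a priori be the symmetric group `S₅`, whose
Jordan constant is `120`. This is where `√5 ∈ K` enters. For an element of `PGL₂(L)` of order five,
represented by a matrix `g`, the invariant `tr(g)² / det(g)` is `(3 ± √5) / 2`, which the Galois
involution fixes, while the invariant of the square is the conjugate number. So no element of order
five in `G` is conjugate in `G` to its square (`conj_inl_ne_sq`). A group of order `120` with this
property has a nontrivial abelian normal subgroup, by the study of its action on its Sylow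
`5`-subgroups (`finiteJordanConstant_le_sixty_of_card_eq`).
-/

/-! ### Finite groups acting with two fixed points per nontrivial element -/

/-- The orbit equation with three orbits, of sizes `o i` and stabilizer orders `e i`. It says
`∑ 1 / e i = 1 + 2 / n`, so, apart from the case of an orbit of size at most two, the `e i` are
`2, 3, z` with `z ∈ {3, 4, 5}`. -/
theorem exists_le_two_or_eq_of_orbit_equation {n : ℕ} {o e : Fin 3 → ℕ}
    (hoe : ∀ i, o i * e i = n) (he : ∀ i, 2 ≤ e i) (hsum : o 0 + o 1 + o 2 = n + 2) :
    (∃ i, o i ≤ 2) ∨ n = 12 ∨ n = 24 ∨ n = 60 := by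
  -- The ordered case `c ≤ b ≤ a`, where `x = 2`, `y = 3` and `z < 6` are forced in turn.
  have key : ∀ a b c x y z : ℕ, a * x = n → b * y = n → c * z = n → 2 ≤ x → 2 ≤ y → 2 ≤ z →
      a + b + c = n + 2 → 3 ≤ c → c ≤ b → b ≤ a → n = 12 ∨ n = 24 ∨ n = 60 := by
    intro a b c x y z hx hy hz hx2 hy2 hz2 hs hc hcb hba
    have h1 : x = 2 := by
      by_contra hne
      have : a * 3 ≤ a * x := Nat.mul_le_mul_left a (by omega)
      omega
    subst h1
    have h2 : y < 4 := by
      by_contra hne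
      have : b * 4 ≤ b * y := Nat.mul_le_mul_left b (by omega)
      omega
    have h3 : y = 3 := by
      by_contra hne
      obtain rfl : y = 2 := by omega
      omega
    subst h3
    have h4 : z < 6 := by
      by_contra hne
      have : c * 6 ≤ c * z := Nat.mul_le_mul_left c (by omega)
      omega
    interval_cases z <;> omega
  by_contra! H
  obtain ⟨H, h12, h24, h60⟩ := H
  have k := fun i j k => key (o i) (o j) (o k) (e i) (e j) (e k) (hoe i) (hoe j) (hoe k)
    (he i) (he j) (he k)
  have k1 := k 0 1 2
  have k2 := k 0 2 1
  have k3 := k 1 0 2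
  have k4 := k 1 2 0
  have k5 := k 2 0 1
  have k6 := k 2 1 0
  have := H 0
  have := H 1
  have := H 2
  omega

/-- The set of points with nontrivial stabilizer, as an invariant subset. -/
def nontrivialStabilizerPoints (G X : Type*) [Group G] [MulAction G X] : SubMulAction G X where
  carrier := {x | ∃ g : G, g ≠ 1 ∧ g • x = x}
  smul_mem' := by
    rintro c x ⟨g, hg, hx⟩
    exact ⟨c * g * c⁻¹, by simpa using hg, by simp [mul_smul, hx]⟩

open MulAction in
/-- Burnside's lemma, applied to the finitely many points with nontrivial stabilizer, where every
`g ≠ 1` again has exactly two fixed points. It gives at most three orbits there, whose sizes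
satisfy the orbit equation. -/
theorem exists_index_stabilizer_le_two_or_card_eq {G X : Type*} [Group G] [Finite G]
    [Nontrivial G] [MulAction G X] (h : ∀ g : G, g ≠ 1 → (fixedBy X g).ncard = 2) :
    (∃ x : X, (stabilizer G x).index ≤ 2) ∨
      Nat.card G = 12 ∨ Nat.card G = 24 ∨ Nat.card G = 60 := by
  classical
  have := Fintype.ofFinite G
  let Y := nontrivialStabilizerPoints G X
  have hfin : ∀ g : G, g ≠ 1 → (fixedBy X g).Finite := fun g hg =>
    Set.finite_of_ncard_ne_zero (by rw [h g hg]; norm_num)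
  have hYfin : Finite Y := by
    have : (Y : Set X) = ⋃ g ∈ {g : G | g ≠ 1}, fixedBy X g := by
      ext x
      simp [Y, nontrivialStabilizerPoints]
      rfl
    refine Set.Finite.to_subtype (s := (Y : Set X)) ?_
    rw [this]
    exact (Set.toFinite _).biUnion fun g hg => hfin g hg
  have := Fintype.ofFinite Y
  let Ω := Quotient (orbitRel G Y)
  have : Fintype Ω := Fintype.ofFinite Ω
  have hfix : ∀ g : G, g ≠ 1 → Fintype.card (fixedBy Y g) = 2 := by
    intro g hg
    rw [← h g hg, ← Nat.card_coe_set_eq, ← Nat.card_eq_fintype_card]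
    exact Nat.card_congr
      { toFun := fun y => ⟨y.1.1, congrArg Subtype.val y.2⟩
        invFun := fun x => ⟨⟨x.1, g, hg, x.2⟩, Subtype.ext x.2⟩
        left_inv := fun _ => rfl
        right_inv := fun _ => rfl }
  have hb := sum_card_fixedBy_eq_card_orbits_mul_card_group G Y
  rw [← Finset.add_sum_erase _ _ (Finset.mem_univ (1 : G)),
    Finset.sum_congr rfl (fun g hg => hfix g (Finset.ne_of_mem_erase hg)),
    Finset.sum_const, Finset.card_erase_of_mem (Finset.mem_univ _), Finset.card_univ,
    smul_eq_mul] at hb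
  have h1 : Fintype.card (fixedBy Y (1 : G)) = Fintype.card Y :=
    Fintype.card_congr (Equiv.subtypeUnivEquiv fun y => one_smul G y)
  have hY : Fintype.card Y = ∑ ω : Ω, (stabilizer G ω.out).index := by
    rw [Fintype.card_congr (selfEquivSigmaOrbitsQuotientStabilizer G Y), Fintype.card_sigma]
    exact Finset.sum_congr rfl fun ω _ => by
      rw [← Nat.card_eq_fintype_card, Subgroup.index]
  have hn : 1 < Fintype.card G := Fintype.one_lt_card
  have hoe : ∀ ω : Ω, (stabilizer G ω.out).index * Nat.card (stabilizer G ω.out)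
      = Fintype.card G := fun ω => by
    rw [Subgroup.index_mul_card, Nat.card_eq_fintype_card]
  have he : ∀ ω : Ω, 2 ≤ Nat.card (stabilizer G ω.out) := fun ω => by
    obtain ⟨g, hg, hx⟩ := ω.out.2
    have : Nontrivial (stabilizer G ω.out) :=
      ⟨⟨⟨g, Subtype.ext hx⟩, 1, fun hh => hg (congrArg Subtype.val hh)⟩⟩
    exact Finite.one_lt_card
  have hstab : ∀ y : Y, stabilizer G y = stabilizer G (y : X) := fun y => by
    ext g
    simp [mem_stabilizer_iff, Subtype.ext_iff]
  by_cases hle : ∃ ω : Ω, (stabilizer G ω.out).index ≤ 2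
  · obtain ⟨ω, hω⟩ := hle
    exact Or.inl ⟨ω.out, hstab ω.out ▸ hω⟩
  right
  rw [h1, hY] at hb
  have hsum : ∑ ω : Ω, (stabilizer G ω.out).index * 2 ≤ ∑ _ω : Ω, Fintype.card G :=
    Finset.sum_le_sum fun ω _ => hoe ω ▸ Nat.mul_le_mul_left _ (he ω)
  rw [← Finset.sum_mul, Finset.sum_const, Finset.card_univ, smul_eq_mul] at hsum
  rw [show Fintype.card (Quotient (orbitRel G Y)) = Fintype.card Ω from rfl] at hb
  -- Every orbit has at most `|G| / 2` points, which leaves room for at most three orbits.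
  have hr : Fintype.card Ω < 4 := by
    by_contra hr
    have : 4 * Fintype.card G ≤ Fintype.card Ω * Fintype.card G :=
      Nat.mul_le_mul_right _ (by omega)
    omega
  push Not at hle
  rw [Nat.card_eq_fintype_card]
  obtain ⟨r, hr'⟩ : ∃ r, Fintype.card Ω = r := ⟨_, rfl⟩
  have f : Fin r ≃ Ω := (Fintype.equivFinOfCardEq hr').symm
  rw [← f.sum_comp, hr'] at hb
  rw [hr'] at hr
  interval_cases r
  · rw [Fin.sum_univ_zero] at hb
    omega
  · rw [Fin.sum_univ_one] at hb
    have := hle (f 0)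
    omega
  · rw [Fin.sum_univ_two] at hb
    have := hle (f 0)
    have := hle (f 1)
    omega
  · rw [Fin.sum_univ_three] at hb
    refine (exists_le_two_or_eq_of_orbit_equation (fun i => hoe (f i)) (fun i => he (f i))
      (by omega)).resolve_left ?_
    rintro ⟨i, hi⟩
    exact absurd (hle (f i)) (by omega)

/-! ### Finite subgroups of `PGL₂` over a field of characteristic zero -/

section ProjectiveLine

open Matrix Matrix.ProjGenLinGroup MulAction OnePoint

variable {F : Type*} [Field F]

/-- In characteristic zero the powers of a parabolic matrix are parabolic, hence never scalar. -/
theorem not_isParabolic_of_isOfFinOrder_mk [CharZero F] {g : GL (Fin 2) F}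
    (hg : IsOfFinOrder (mk g)) : ¬ g.IsParabolic := by
  intro hpar
  obtain ⟨n, hn, hpow⟩ := isOfFinOrder_iff_pow_eq_one.1 hg
  rw [← map_pow, mk_eq_one, GeneralLinearGroup.mem_center_iff_val_mem_range_scalar] at hpow
  exact (hpar.pow hn.ne').1 hpow

theorem map_injective_of_field {E : Type*} [Field E] (f : F →+* E) :
    Function.Injective (map (n := Fin 2) f) := by
  rw [injective_iff_map_eq_one]
  intro g hg
  induction g using ProjGenLinGroup.induction_on with | mk g =>
  rw [map_mk, mk_eq_one, GeneralLinearGroup.mem_center_iff_val_mem_range_scalar] at hg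
  rw [mk_eq_one, GeneralLinearGroup.mem_center_iff_val_mem_range_scalar]
  obtain ⟨a, ha⟩ := hg
  have h00 := congrFun₂ ha 0 0
  have h01 := congrFun₂ ha 0 1
  have h10 := congrFun₂ ha 1 0
  have h11 := congrFun₂ ha 1 1
  simp at h00 h01 h10 h11
  refine ⟨g.val 0 0, ?_⟩
  have h := f.injective (h00.symm.trans h11)
  have h01' := f.injective ((map_zero f).trans h01)
  have h10' := f.injective ((map_zero f).trans h10)
  ext i j
  fin_cases i <;> fin_cases j <;> simp [h, ← h01', ← h10']

/-- A commutator `c` of upper triangular matrices has equal diagonal entries; the relation is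
written as `c * (h * g) = g * h` to keep it free of inverse matrices. -/
theorem diag_eq_of_mul_eq {c g h : GL (Fin 2) F} (hc : c 1 0 = 0) (hg : g 1 0 = 0)
    (hh : h 1 0 = 0) (e : c * (h * g) = g * h) : c 0 0 = c 1 1 := by
  have hgd := g.det_ne_zero
  have hhd := h.det_ne_zero
  rw [det_fin_two] at hgd hhd
  have e' := congrArg Units.val e
  have h00 := congrFun₂ e' 0 0
  have h11 := congrFun₂ e' 1 1
  simp [Matrix.mul_apply, Fin.sum_univ_two, hc, hg, hh] at h00 h11 hgd hhd
  grind

variable [DecidableEq F]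

/-- `PGL₂(F)` acts on the projective line `F ∪ {∞}` by Möbius transformations. -/
noncomputable instance pglMulActionOnePoint : MulAction (PGL(2, F)) (OnePoint F) :=
  mulActionOfGL fun u x => by
    cases x with
    | infty => simp [smul_infty_eq_ite]
    | coe x => simp [smul_some_eq_ite]

theorem mk_smul_onePoint (g : GL (Fin 2) F) (x : OnePoint F) : mk g • x = g • x := rfl

/-- The fixed points are the roots, in `F ∪ {∞}`, of a quadratic whose discriminant is that of the
matrix, and this is nonzero because an element of finite order is not parabolic. -/
theorem ncard_fixedBy_eq_two [IsAlgClosed F] [CharZero F] {p : PGL(2, F)} (hp : p ≠ 1)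
    (hfin : IsOfFinOrder p) : (fixedBy (OnePoint F) p).ncard = 2 := by
  induction p using ProjGenLinGroup.induction_on with | mk g =>
  have hpar := not_isParabolic_of_isOfFinOrder_mk hfin
  have hsc : g.val ∉ Set.range (Matrix.scalar (Fin 2)) := fun h =>
    hp (mk_eq_one.2 (GeneralLinearGroup.mem_center_iff_val_mem_range_scalar.2 h))
  have hcoe : ∀ t : F, (t : OnePoint F) ∈ fixedBy (OnePoint F) (mk g) ↔
      g 1 0 * (t * t) + (g 1 1 - g 0 0) * t + -g 0 1 = 0 := by
    intro t
    rw [mem_fixedBy, mk_smul_onePoint, ← GeneralLinearGroup.fixpointPolynomial_aeval_eq_zero_iff]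
    simp [GeneralLinearGroup.fixpointPolynomial, sq, sub_eq_add_neg]
  have hinf : (∞ : OnePoint F) ∈ fixedBy (OnePoint F) (mk g) ↔ g 1 0 = 0 := by
    rw [mem_fixedBy, mk_smul_onePoint, smul_infty_eq_self_iff]
  have hdisc : discrim (g 1 0) (g 1 1 - g 0 0) (-g 0 1) ≠ 0 := by
    intro h
    refine hpar ⟨hsc, ?_⟩
    rw [discr_fin_two, trace_fin_two, det_fin_two]
    rw [discrim] at h
    linear_combination h
  by_cases hc : g 1 0 = 0
  · have hd : g 1 1 - g 0 0 ≠ 0 := by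
      intro h
      simp [discrim, hc, h] at hdisc
    rw [Set.ncard_eq_two]
    refine ⟨∞, ((g 0 1 / (g 1 1 - g 0 0) : F) : OnePoint F), infty_ne_coe _, ?_⟩
    ext x
    cases x with
    | infty => simp only [hinf, hc, Set.mem_insert_iff, true_or]
    | coe t =>
      rw [hcoe, hc, Set.mem_insert_iff, Set.mem_singleton_iff, coe_eq_coe, eq_div_iff hd]
      simp only [coe_ne_infty, false_or]
      grind
  · obtain ⟨s, hs⟩ := IsAlgClosed.exists_pow_nat_eq
      (discrim (g 1 0) (g 1 1 - g 0 0) (-g 0 1)) two_pos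
    rw [sq] at hs
    have hs0 : s ≠ 0 := by
      rintro rfl
      simp at hs
      exact hdisc hs.symm
    rw [Set.ncard_eq_two]
    refine ⟨((-(g 1 1 - g 0 0) + s) / (2 * g 1 0) : F),
      ((-(g 1 1 - g 0 0) - s) / (2 * g 1 0) : F), ?_, ?_⟩
    · rw [Ne, coe_eq_coe]
      field_simp
      intro h
      apply hs0
      grind
    ext x
    cases x with
    | infty =>
      rw [hinf]
      simp [hc]
    | coe t =>
      rw [hcoe, quadratic_eq_zero_iff hc hs.symm]
      simp only [Set.mem_insert_iff, Set.mem_singleton_iff, coe_eq_coe]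

/-- The commutator of two elements fixing `∞` is represented by an upper triangular matrix with
equal diagonal entries. This is parabolic or scalar, and finite order excludes the former. -/
theorem commute_of_smul_infty_eq [CharZero F] {p q : PGL(2, F)}
    (hp : p • (∞ : OnePoint F) = ∞) (hq : q • (∞ : OnePoint F) = ∞)
    (hfin : IsOfFinOrder (p * q * p⁻¹ * q⁻¹)) : p * q = q * p := by
  have hcomm : (p * q * p⁻¹ * q⁻¹) • (∞ : OnePoint F) = ∞ := by
    simp only [mul_smul, inv_smul_eq_iff.2 hp.symm, inv_smul_eq_iff.2 hq.symm, hp, hq]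
  induction p using ProjGenLinGroup.induction_on with | mk g =>
  induction q using ProjGenLinGroup.induction_on with | mk h =>
  simp only [← map_mul, ← map_inv] at hfin hcomm
  rw [mk_smul_onePoint, smul_infty_eq_self_iff] at hp hq hcomm
  have hpar := not_isParabolic_of_isOfFinOrder_mk hfin
  rw [GeneralLinearGroup.isParabolic_iff_of_upperTriangular hcomm] at hpar
  have hd := diag_eq_of_mul_eq hcomm hp hq (by group)
  have hone : mk (g * h * g⁻¹ * h⁻¹) = 1 := by
    rw [mk_eq_one, GeneralLinearGroup.mem_center_iff_val_mem_range_scalar]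
    refine ⟨(g * h * g⁻¹ * h⁻¹) 0 0, ?_⟩
    have h01 : (g * h * g⁻¹ * h⁻¹) 0 1 = 0 := by
      by_contra h01
      exact hpar ⟨hd, h01⟩
    ext i j
    fin_cases i <;> fin_cases j
    · simp
    · simpa using h01.symm
    · simpa using hcomm.symm
    · simpa using hd
  simp only [map_mul, map_inv] at hone
  rwa [mul_inv_eq_one, mul_inv_eq_iff_eq_mul] at hone

theorem exists_smul_infty_eq (x : OnePoint F) : ∃ k : PGL(2, F), k • (∞ : OnePoint F) = x := by
  cases x with
  | infty => exact ⟨1, one_smul _ _⟩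
  | coe t =>
    refine ⟨mk (GeneralLinearGroup.mkOfDetNeZero !![t, 1; 1, 0] (by simp)), ?_⟩
    rw [mk_smul_onePoint, smul_infty_eq_ite]
    simp [GeneralLinearGroup.mkOfDetNeZero]

theorem commute_of_smul_eq [CharZero F] {p q : PGL(2, F)} {x : OnePoint F}
    (hp : p • x = x) (hq : q • x = x)
    (hfin : IsOfFinOrder (p * q * p⁻¹ * q⁻¹)) : p * q = q * p := by
  obtain ⟨k, rfl⟩ := exists_smul_infty_eq x
  have key := commute_of_smul_infty_eq (p := k⁻¹ * p * k) (q := k⁻¹ * q * k)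
    (by simp only [mul_smul, hp, inv_smul_smul]) (by simp only [mul_smul, hq, inv_smul_smul])
    (by
      have : k⁻¹ * p * k * (k⁻¹ * q * k) * (k⁻¹ * p * k)⁻¹ * (k⁻¹ * q * k)⁻¹ =
          MulAut.conj k⁻¹ (p * q * p⁻¹ * q⁻¹) := by
        simp only [MulAut.conj_apply]
        group
      rw [this]
      exact (MulAut.conj k⁻¹).toMonoidHom.isOfFinOrder hfin)
  have := congrArg (fun y => k * y * k⁻¹) key
  simpa [mul_assoc] using this

end ProjectiveLine

open Matrix in
/-- The part of the classification of finite subgroups of `PGL₂` that bounds Jordan constants: the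
first alternative covers the cyclic and dihedral groups, and the orders `12`, `24` and `60` are
those of `A₄`, `S₄` and `A₅`. -/
theorem exists_abelian_index_le_two_or_card_eq {F H : Type*} [Field F] [CharZero F] [Group H]
    [Finite H] (ρ : H →* PGL(2, F)) (hρ : Function.Injective ρ) :
    (∃ A : Subgroup H, (∀ x ∈ A, ∀ y ∈ A, x * y = y * x) ∧ A.index ≤ 2) ∨
      Nat.card H = 12 ∨ Nat.card H = 24 ∨ Nat.card H = 60 := by
  classical
  rcases subsingleton_or_nontrivial H with hH | hH
  · exact Or.inl ⟨⊤, fun x _ y _ => Subsingleton.elim _ _, by simp⟩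
  let f := algebraMap F (AlgebraicClosure F)
  let θ : H →* PGL(2, AlgebraicClosure F) := (ProjGenLinGroup.map f).comp ρ
  have hθ : Function.Injective θ := (map_injective_of_field f).comp hρ
  let : MulAction H (OnePoint (AlgebraicClosure F)) := MulAction.compHom _ θ
  have hfin : ∀ g : H, IsOfFinOrder (θ g) := fun g => θ.isOfFinOrder (isOfFinOrder_of_finite g)
  rcases exists_index_stabilizer_le_two_or_card_eq (G := H)
    (X := OnePoint (AlgebraicClosure F)) (fun g hg => ncard_fixedBy_eq_two
      (p := θ g) (fun h => hg (hθ (h.trans θ.map_one.symm))) (hfin g)) with ⟨x, hx⟩ | h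
  · refine Or.inl ⟨_, fun a ha b hb => hθ ?_, hx⟩
    rw [map_mul, map_mul]
    refine commute_of_smul_eq (x := x) ha hb ?_
    simpa only [map_mul, map_inv] using hfin (a * b * a⁻¹ * b⁻¹)
  · exact Or.inr h

/-! ### Jordan constants of finite groups and groups of order 120 -/

section GroupTheory

variable {G : Type*} [Group G]

theorem finiteJordanConstant_le_index [Finite G] (N : Subgroup G) [N.Normal]
    (hN : ∀ x ∈ N, ∀ y ∈ N, x * y = y * x) : finiteJordanConstant G ≤ N.index :=
  Nat.sInf_le ⟨N, inferInstance, hN, rfl⟩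

theorem finiteJordanConstant_le_card [Finite G] : finiteJordanConstant G ≤ Nat.card G := by
  rw [← Subgroup.index_bot]
  refine finiteJordanConstant_le_index ⊥ fun x hx y hy => ?_
  rw [Subgroup.mem_bot.1 hx, Subgroup.mem_bot.1 hy]

theorem index_normalCore_dvd_factorial (A : Subgroup G) [A.FiniteIndex] :
    A.normalCore.index ∣ A.index.factorial := by
  classical
  rw [Subgroup.normalCore_eq_ker, Subgroup.index_ker, Subgroup.index, ← Nat.card_perm]
  exact Subgroup.card_subgroup_dvd_card _

theorem finiteJordanConstant_le_factorial_index [Finite G] (A : Subgroup G)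
    (hA : ∀ x ∈ A, ∀ y ∈ A, x * y = y * x) : finiteJordanConstant G ≤ A.index.factorial :=
  (finiteJordanConstant_le_index A.normalCore fun x hx y hy =>
    hA x (A.normalCore_le hx) y (A.normalCore_le hy)).trans
    (Nat.le_of_dvd (Nat.factorial_pos _) (index_normalCore_dvd_factorial A))

theorem mul_comm_of_card_dvd_four (K : Subgroup G) (h : Nat.card K ∣ 4) :
    ∀ x ∈ K, ∀ y ∈ K, x * y = y * x := by
  have h4 : Nat.card K = 1 ∨ Nat.card K = 2 ∨ Nat.card K = 4 := by
    have := Nat.le_of_dvd (by norm_num) h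
    interval_cases Nat.card K <;> simp_all
  have hK : ∀ x y : K, x * y = y * x := by
    rcases h4 with h | h | h
    · have := (Nat.card_eq_one_iff_unique.1 h).1
      exact fun _ _ => Subsingleton.elim _ _
    · have : Fact (Nat.Prime 2) := ⟨Nat.prime_two⟩
      have := isCyclic_of_prime_card h
      exact fun x y => mul_comm' x y
    · have : Fact (Nat.Prime 2) := ⟨Nat.prime_two⟩
      have := IsPGroup.isMulCommutative_of_card_eq_prime_sq (p := 2) (G := K) h
      exact fun x y => mul_comm' x y
  exact fun x hx y hy => congrArg Subtype.val (hK ⟨x, hx⟩ ⟨y, hy⟩)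

theorem mem_sylow_of_smul_eq {p : ℕ} [Fact p.Prime] {x : G} (hx : orderOf x = p)
    {Q : Sylow p G} (h : x • Q = Q) : x ∈ Q := by
  have hp : IsPGroup p (Subgroup.zpowers x) :=
    IsPGroup.of_card (n := 1) (by rw [Nat.card_zpowers, hx, pow_one])
  refine hp.sylow_mem_fixedPoints_iff.1 ?_ (Subgroup.mem_zpowers x)
  rintro ⟨y, hy⟩
  have : Subgroup.zpowers x ≤ MulAction.stabilizer G Q := by
    rw [Subgroup.zpowers_le]
    exact h
  exact this hy

theorem zpowers_eq_of_mem_sylow {p : ℕ} [Fact p.Prime] {x : G} (hx : orderOf x = p)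
    {Q : Sylow p G} (hQ : Nat.card Q = p) (h : x ∈ Q) : Subgroup.zpowers x = Q := by
  have : Finite Q := Nat.finite_of_card_ne_zero (hQ.trans_ne (Fact.out : p.Prime).ne_zero)
  exact Subgroup.eq_of_le_of_card_ge (Subgroup.zpowers_le.2 h)
    (by rw [Nat.card_zpowers, hx]; exact hQ.le)

/-- Conjugation by elements of the normalizer of `⟨x⟩` sends `x` to a power `x ^ i`. Here `i = 2`
is excluded by hypothesis and `i = 3` because `3 ^ 3 ≡ 2` modulo `5`, so `i = ±1` and the
centralizer of `x` has index at most two in the normalizer. -/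
theorem exists_orderOf_eq_two_of_normalizer [Finite G] {x : G} (hx : orderOf x = 5)
    (hconj : ∀ g : G, g * x * g⁻¹ ≠ x ^ 2)
    (hN : 4 ∣ Nat.card (Subgroup.normalizer (Subgroup.zpowers x : Set G))) :
    ∃ z : G, orderOf z = 2 ∧ Commute z x := by
  classical
  let N := Subgroup.normalizer (Subgroup.zpowers x : Set G)
  let C := (Subgroup.centralizer {x}).subgroupOf N
  have hmem : ∀ g : N, g ∈ C ↔ (g : G) * x * (g : G)⁻¹ = x := fun g => by
    rw [Subgroup.mem_subgroupOf, Subgroup.mem_centralizer_singleton_iff, mul_inv_eq_iff_eq_mul]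
  have hx5 : x ^ 5 = 1 := hx ▸ pow_orderOf_eq_one x
  have hinv : ∀ g : N, g ∉ C → (g : G) * x * (g : G)⁻¹ = x⁻¹ := by
    intro g hg
    have h1 : (g : G) * x * (g : G)⁻¹ ∈ Subgroup.zpowers x :=
      (Subgroup.mem_normalizer_iff.1 g.2 x).1 (Subgroup.mem_zpowers x)
    rw [mem_zpowers_iff_mem_range_orderOf, hx] at h1
    obtain ⟨i, hi, he⟩ := Finset.mem_image.1 h1
    rw [Finset.mem_range] at hi
    change x ^ i = _ at he
    interval_cases i
    · rw [pow_zero, eq_comm, conj_eq_one_iff] at he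
      rw [he, orderOf_one] at hx
      omega
    · exact absurd ((hmem g).2 (by rw [← he, pow_one])) hg
    · exact absurd he.symm (hconj g)
    · refine absurd ?_ (hconj ((g : G) * g * g))
      have h9 : (g : G) * (g * x * (g : G)⁻¹) * (g : G)⁻¹ = x ^ 9 := by
        rw [← he, ← conj_pow, ← he, ← pow_mul]
      have h27 : (g : G) * (g * (g * x * (g : G)⁻¹) * (g : G)⁻¹) * (g : G)⁻¹ = x ^ 27 := by
        rw [h9, ← conj_pow, ← he, ← pow_mul]
      rw [show x ^ 2 = x ^ 27 by rw [show 27 = 5 * 5 + 2 by rfl, pow_add, pow_mul, hx5]; simp,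
        ← h27]
      group
    · rw [← he, eq_inv_iff_mul_eq_one, ← pow_succ, hx5]
  have hidx : C.index ∣ 2 := by
    by_cases hC : C = ⊤
    · simp [hC]
    obtain ⟨a, ha⟩ : ∃ a, a ∉ C := by
      by_contra! h
      exact hC (eq_top_iff.2 fun y _ => h y)
    refine (Subgroup.index_eq_two_iff.2 ⟨a, fun b => ?_⟩).dvd
    by_cases hb : b ∈ C
    · exact Or.inr ⟨hb, fun h => ha ((C.mul_mem_cancel_left hb).1 h)⟩
    · refine Or.inl ⟨(hmem _).2 ?_, hb⟩
      have e : ((b * a : N) : G) * x * ((b * a : N) : G)⁻¹ =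
          (b : G) * (a * x * (a : G)⁻¹) * (b : G)⁻¹ := by
        simp [mul_assoc]
      rw [e, hinv a ha, ← conj_inv, hinv b hb, inv_inv]
  have h2 : 2 ∣ Nat.card C := by
    have h := C.card_mul_index
    obtain ⟨m, hm⟩ := hN
    change Nat.card N = _ at hm
    rw [hm] at h
    have hc := (Nat.dvd_prime Nat.prime_two).1 hidx
    rcases hc with hc | hc <;> rw [hc] at h <;> omega
  have : Fact (Nat.Prime 2) := ⟨Nat.prime_two⟩
  obtain ⟨z, hz⟩ := exists_prime_orderOf_dvd_card' 2 h2
  refine ⟨((z : N) : G), by rw [Subgroup.orderOf_coe, Subgroup.orderOf_coe, hz], ?_⟩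
  exact mul_inv_eq_iff_eq_mul.1 ((hmem z).1 z.2)

open MulAction in
/-- The set `S` of Sylow `5`-subgroups fixed by `z` has an even number of elements, since `6` is
even and `z` is an involution. It is stable under `x`, which fixes a single Sylow `5`-subgroup, so
`|S| ≡ 1` modulo `5`. Hence `|S| = 6`. -/
theorem smul_sylow_eq_of_commute [Finite G] {x z : G} (hcard : Nat.card (Sylow 5 G) = 6)
    (h5 : ∀ Q : Sylow 5 G, Nat.card Q = 5)
    (hx : orderOf x = 5) (hz : orderOf z = 2) (hzx : Commute z x) (Q : Sylow 5 G) :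
    z • Q = Q := by
  have : Fact (Nat.Prime 2) := ⟨Nat.prime_two⟩
  have : Fact (Nat.Prime 5) := ⟨Nat.prime_five⟩
  let S := {Q : Sylow 5 G | z • Q = Q}
  let Y : SubMulAction (Subgroup.zpowers x) (Sylow 5 G) :=
    { carrier := S
      smul_mem' := by
        rintro ⟨c, hc⟩ R hR
        obtain ⟨k, rfl⟩ := Subgroup.mem_zpowers_iff.1 hc
        change z • (x ^ k) • R = (x ^ k) • R
        rw [← mul_smul, (hzx.zpow_right k).eq, mul_smul, hR] }
  have e2 : Nat.card (Sylow 5 G) ≡ Nat.card S [MOD 2] := by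
    have h := (IsPGroup.of_card (p := 2) (n := 1) (G := Subgroup.zpowers z)
      (by rw [Nat.card_zpowers, hz, pow_one])).card_modEq_card_fixedPoints (Sylow 5 G)
    have hS : fixedPoints (Subgroup.zpowers z) (Sylow 5 G) = S := by
      ext R
      refine ⟨fun hR => hR ⟨z, Subgroup.mem_zpowers z⟩, fun hR => ?_⟩
      rintro ⟨y, hy⟩
      have : Subgroup.zpowers z ≤ stabilizer G R := by
        rw [Subgroup.zpowers_le]
        exact hR
      exact this hy
    rwa [hS] at h
  obtain ⟨P, hP⟩ := IsPGroup.exists_le_sylow (p := 5) (P := Subgroup.zpowers x)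
    (IsPGroup.of_card (n := 1) (by rw [Nat.card_zpowers, hx, pow_one]))
  have hxP : Subgroup.zpowers x = P :=
    zpowers_eq_of_mem_sylow hx (h5 P) (hP (Subgroup.mem_zpowers x))
  have hfix : ∀ R : Sylow 5 G, x • R = R → R = P := fun R hR =>
    Sylow.ext ((zpowers_eq_of_mem_sylow hx (h5 R) (mem_sylow_of_smul_eq hx hR)).symm.trans hxP)
  have hPfix : ∀ y ∈ Subgroup.zpowers x, y • P = P := fun y hy =>
    Sylow.smul_eq_iff_mem_normalizer.2 (Subgroup.le_normalizer (hP hy))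
  have hPS : P ∈ S := by
    refine hfix _ ?_
    rw [← mul_smul, ← hzx.eq, mul_smul, hPfix x (Subgroup.mem_zpowers x)]
  have e5 : Nat.card S ≡ 1 [MOD 5] := by
    have h := (IsPGroup.of_card (p := 5) (n := 1) (G := Subgroup.zpowers x)
      (by rw [Nat.card_zpowers, hx, pow_one])).card_modEq_card_fixedPoints Y
    have hY : Nat.card (fixedPoints (Subgroup.zpowers x) Y) = 1 := by
      rw [Nat.card_eq_one_iff_exists]
      refine ⟨⟨⟨P, hPS⟩, ?_⟩, ?_⟩
      · rintro ⟨y, hy⟩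
        exact Subtype.ext (hPfix y hy)
      · rintro ⟨⟨R, hR⟩, hR'⟩
        have := congrArg Subtype.val (hR' ⟨x, Subgroup.mem_zpowers x⟩)
        exact Subtype.ext (Subtype.ext (hfix R this))
    rwa [hY] at h
  have hle : Nat.card S ≤ 6 := hcard ▸ Finite.card_subtype_le _
  have h6 : Nat.card S = 6 := by
    rw [hcard] at e2
    unfold Nat.ModEq at e2 e5
    omega
  have hS : S = Set.univ :=
    Set.eq_of_subset_of_ncard_le (Set.subset_univ S) (by
      rw [Set.ncard_univ, hcard, ← Nat.card_coe_set_eq, h6])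
  exact hS.symm.subset (Set.mem_univ Q)

/-- If the Sylow `5`-subgroup is not normal, there are six of them and the kernel `K` of the
conjugation action on them is a nontrivial abelian normal subgroup: it contains an involution, and
its order divides `4` because it lies in a normalizer of order `20` and has no element of
order `5`. -/
theorem finiteJordanConstant_le_sixty_of_card_eq [Finite G] (hG : Nat.card G = 120)
    (hconj : ∀ x g : G, orderOf x = 5 → g * x * g⁻¹ ≠ x ^ 2) :
    finiteJordanConstant G ≤ 60 := by
  have : Fact (Nat.Prime 5) := ⟨Nat.prime_five⟩
  have h5 : ∀ Q : Sylow 5 G, Nat.card Q = 5 := fun Q => by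
    rw [Q.card_eq_multiplicity, hG, show 120 = 24 * 5 ^ 1 by rfl,
      Nat.factorization_mul (by norm_num) (by norm_num), Finsupp.add_apply,
      Nat.factorization_eq_zero_of_not_dvd (by norm_num), Nat.Prime.factorization_pow Nat.prime_five]
    simp
  obtain ⟨P⟩ : Nonempty (Sylow 5 G) := inferInstance
  have hPi : (P : Subgroup G).index = 24 := by
    have h := (P : Subgroup G).card_mul_index
    rw [hG] at h
    have := h5 P
    change Nat.card (P : Subgroup G) = 5 at this
    rw [this] at h
    omega
  have hdvd := P.card_dvd_index
  have hmod := card_sylow_modEq_one 5 G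
  rw [hPi] at hdvd
  have hcard : Nat.card (Sylow 5 G) = 1 ∨ Nat.card (Sylow 5 G) = 6 := by
    unfold Nat.ModEq at hmod
    have := Nat.le_of_dvd (by norm_num) hdvd
    interval_cases Nat.card (Sylow 5 G) <;> omega
  rcases hcard with hcard | hcard
  · have := (Nat.card_eq_one_iff_unique.1 hcard).1
    have := P.normal_of_subsingleton
    refine (finiteJordanConstant_le_index (P : Subgroup G) ?_).trans (by omega)
    have := isCyclic_of_prime_card (h5 P)
    exact fun x hx y hy => congrArg Subtype.val (mul_comm' (⟨x, hx⟩ : P) ⟨y, hy⟩)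
  · have hN : Nat.card (Subgroup.normalizer (P : Set G)) = 20 := by
      have h := (Subgroup.normalizer (P : Set G)).card_mul_index
      rw [← P.card_eq_index_normalizer, hcard, hG] at h
      omega
    let K := (MulAction.toPermHom G (Sylow 5 G)).ker
    have hK : ∀ k : G, k ∈ K ↔ ∀ Q : Sylow 5 G, k • Q = Q := fun k => by
      rw [MonoidHom.mem_ker, Equiv.ext_iff]
      rfl
    have hKN : K ≤ Subgroup.normalizer (P : Set G) := fun k hk =>
      Sylow.smul_eq_iff_mem_normalizer.1 ((hK k).1 hk P)
    have hK20 : Nat.card K ∣ 4 * 5 := (Subgroup.card_dvd_of_le hKN).trans hN.dvd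
    have hK5 : ¬ 5 ∣ Nat.card K := by
      intro h
      obtain ⟨k, hk⟩ := exists_prime_orderOf_dvd_card' 5 h
      have hk' : orderOf (k : G) = 5 := by rw [Subgroup.orderOf_coe, hk]
      have hQ : ∀ Q : Sylow 5 G, Subgroup.zpowers (k : G) = Q := fun Q =>
        zpowers_eq_of_mem_sylow hk' (h5 Q) (mem_sylow_of_smul_eq hk' ((hK k).1 k.2 Q))
      have : Subsingleton (Sylow 5 G) :=
        ⟨fun Q R => Sylow.ext ((hQ Q).symm.trans (hQ R))⟩
      have := Nat.card_of_subsingleton P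
      omega
    have hK4 : Nat.card K ∣ 4 :=
      Nat.Coprime.dvd_of_dvd_mul_right
        ((Nat.Prime.coprime_iff_not_dvd Nat.prime_five).2 hK5).symm hK20
    obtain ⟨x, hx⟩ := exists_prime_orderOf_dvd_card' (G := P) 5 (by rw [h5 P])
    have hx' : orderOf (x : G) = 5 := (Subgroup.orderOf_coe x).trans hx
    have hxP := zpowers_eq_of_mem_sylow hx' (h5 P) x.2
    obtain ⟨z, hz, hzx⟩ := exists_orderOf_eq_two_of_normalizer hx' (fun g => hconj x g hx')
      (by rw [hxP]; exact ⟨5, hN⟩)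
    have hzK : z ∈ K := (hK z).2 fun Q => smul_sylow_eq_of_commute hcard h5 hx' hz hzx Q
    have hne : 1 < Nat.card K := by
      have : Nontrivial K := ⟨⟨⟨z, hzK⟩, 1, fun h => by
        have h1 : z = 1 := congrArg Subtype.val h
        rw [h1, orderOf_one] at hz
        omega⟩⟩
      exact Finite.one_lt_card
    refine (finiteJordanConstant_le_index K (mul_comm_of_card_dvd_four K hK4)).trans ?_
    have h := K.card_mul_index
    rw [hG] at h
    have : 2 * K.index ≤ Nat.card K * K.index := Nat.mul_le_mul_right _ hne
    omega

end GroupTheory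

/-! ### The invariant `tr² / det` of elements of order five -/

section TraceInvariant

open Matrix Matrix.ProjGenLinGroup

variable {F : Type*} [Field F]

/-- The quantity `tr(g)² / det(g)`, which depends only on the conjugacy class of the image of `g`
in `PGL₂(F)`. -/
noncomputable def traceSqDivDet (g : GL (Fin 2) F) : F := g.val.trace ^ 2 / g.val.det

theorem traceSqDivDet_eq_of_mk_eq {g h : GL (Fin 2) F} (e : mk g = mk h) :
    traceSqDivDet g = traceSqDivDet h := by
  obtain ⟨u, rfl⟩ := mk_eq_mk_iff.1 e
  have hd := g.det_ne_zero
  have hu := u.ne_zero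
  have e1 : (g * GeneralLinearGroup.scalar (Fin 2) u).val = (u : F) • g.val := by
    ext i j
    fin_cases j <;> simp [Matrix.mul_apply, mul_comm]
  rw [traceSqDivDet, traceSqDivDet, e1, trace_smul, det_smul, smul_eq_mul, Fintype.card_fin,
    mul_pow, mul_div_mul_left _ _ (pow_ne_zero 2 hu)]

theorem traceSqDivDet_conj (k g : GL (Fin 2) F) :
    traceSqDivDet (k * g * k⁻¹) = traceSqDivDet g := by
  rw [traceSqDivDet, traceSqDivDet, Units.val_mul, Units.val_mul, trace_units_conj,
    det_units_conj]

theorem traceSqDivDet_map {E : Type*} [Field E] (f : F →+* E) (g : GL (Fin 2) F) :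
    traceSqDivDet (GeneralLinearGroup.map f g) = f (traceSqDivDet g) := by
  simp [traceSqDivDet, trace_fin_two, det_fin_two]

theorem traceSqDivDet_sq (g : GL (Fin 2) F) :
    traceSqDivDet (g ^ 2) = (traceSqDivDet g - 2) ^ 2 := by
  have hd := g.det_ne_zero
  have ht : (g.val ^ 2).trace = g.val.trace ^ 2 - 2 * g.val.det := by
    simp only [sq, trace_fin_two, det_fin_two, Matrix.mul_apply, Fin.sum_univ_two]
    ring
  rw [traceSqDivDet, traceSqDivDet, Units.val_pow_eq_pow_val, det_pow, ht]
  field_simp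

/-- By the Cayley–Hamilton theorem `g ^ 5` is a scalar plus `(t ^ 4 - 3 t² d + d²) • g`, where
`t = tr g` and `d = det g`, and this coefficient of the nonscalar matrix `g` has to vanish. -/
theorem traceSqDivDet_of_orderOf_eq_five {g : GL (Fin 2) F} (hg : orderOf (mk g) = 5) :
    traceSqDivDet g ^ 2 - 3 * traceSqDivDet g + 1 = 0 := by
  have hd := g.det_ne_zero
  suffices h : g.val.trace ^ 4 - 3 * g.val.trace ^ 2 * g.val.det + g.val.det ^ 2 = 0 by
    rw [traceSqDivDet]
    field_simp
    linear_combination h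
  have h5 : mk g ^ 5 = 1 := hg ▸ pow_orderOf_eq_one _
  rw [← map_pow, mk_eq_one, GeneralLinearGroup.mem_center_iff_val_mem_range_scalar] at h5
  obtain ⟨a, ha⟩ := h5
  have h00 := congrFun₂ ha 0 0
  have h01 := congrFun₂ ha 0 1
  have h10 := congrFun₂ ha 1 0
  have h11 := congrFun₂ ha 1 1
  simp [pow_succ, Matrix.mul_apply, Fin.sum_univ_two] at h00 h01 h10 h11
  by_contra hne
  rw [trace_fin_two, det_fin_two] at hne
  have e01 : g.val 0 1 = 0 := by
    refine (mul_eq_zero.1 ?_).resolve_right hne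
    linear_combination -h01
  have e10 : g.val 1 0 = 0 := by
    refine (mul_eq_zero.1 ?_).resolve_right hne
    linear_combination -h10
  have e11 : g.val 0 0 - g.val 1 1 = 0 := by
    refine (mul_eq_zero.1 ?_).resolve_right hne
    linear_combination h11 - h00
  have : mk g = 1 := by
    rw [mk_eq_one, GeneralLinearGroup.mem_center_iff_val_mem_range_scalar]
    refine ⟨g.val 0 0, ?_⟩
    ext i j
    fin_cases i <;> fin_cases j
    · simp
    · simp [e01]
    · simp [e10]
    · simpa [sub_eq_zero] using e11
  rw [this, orderOf_one] at hg
  omega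

theorem traceSqDivDet_sq_ne [CharZero F] {g : GL (Fin 2) F} (hg : orderOf (mk g) = 5) :
    traceSqDivDet (g ^ 2) ≠ traceSqDivDet g := by
  intro h
  have e := traceSqDivDet_of_orderOf_eq_five hg
  rw [traceSqDivDet_sq] at h
  have h3 : 2 * traceSqDivDet g = 3 := by linear_combination e - h
  have h5 : (5 : F) = 0 := by
    linear_combination (2 * traceSqDivDet g - 3) * h3 - 4 * e
  exact OfNat.ofNat_ne_zero 5 h5

variable {K : Type*} [Field K] [Algebra K F]

/-- The roots `(3 ± √5) / 2` of the equation satisfied by the invariant of an element of order five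
lie in `K`. -/
theorem algEquiv_traceSqDivDet_eq [CharZero F] (h5 : ∃ s : K, s ^ 2 = 5) (σ : F ≃ₐ[K] F)
    {g : GL (Fin 2) F} (hg : orderOf (mk g) = 5) :
    σ (traceSqDivDet g) = traceSqDivDet g := by
  obtain ⟨s, hs⟩ := h5
  have e := traceSqDivDet_of_orderOf_eq_five hg
  have hs' : algebraMap K F s ^ 2 = 5 := by rw [← map_pow, hs, map_ofNat]
  have hsq : (2 * traceSqDivDet g - 3) ^ 2 = algebraMap K F s ^ 2 := by
    linear_combination 4 * e - hs'
  obtain ⟨c, hc⟩ : ∃ c : K, 2 * traceSqDivDet g - 3 = algebraMap K F c := by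
    rcases sq_eq_sq_iff_eq_or_eq_neg.1 hsq with h | h
    · exact ⟨s, h⟩
    · exact ⟨-s, by rw [h, map_neg]⟩
  have h2 : (2 : F) ≠ 0 := two_ne_zero
  have hσ := congrArg σ hc
  rw [AlgEquiv.commutes, ← hc] at hσ
  simp only [map_sub, map_mul, map_ofNat] at hσ
  exact mul_left_cancel₀ h2 (by linear_combination hσ)

end TraceInvariant

section Semidirect

open Matrix Matrix.ProjGenLinGroup

variable (K L : Type*) [Field K] [CharZero K] [Field L] [Algebra K L]
  [Algebra.IsQuadraticExtension K L]

/-- An element of order five of `PGL₂(L)` is not conjugate to its square, not even by an element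
acting through the Galois involution. In particular no automorphism of an icosahedral subgroup
which is induced by the semidirect product interchanges its two classes of elements of order five,
and the symmetric group `S₅` does not occur. -/
theorem conj_inl_ne_sq (h5 : ∃ s : K, s ^ 2 = 5)
    (w : PGL(2, L) ⋊[pglGaloisAction K L] Multiplicative (ZMod 2)) {u : PGL(2, L)}
    (hu : orderOf u = 5) :
    w * SemidirectProduct.inl u * w⁻¹ ≠ (SemidirectProduct.inl u) ^ 2 := by
  have : CharZero L := charZero_of_injective_algebraMap (algebraMap K L).injective
  intro h
  have hl : w.left * pglGaloisAction K L w.right u * w.left⁻¹ = u ^ 2 := by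
    have := congrArg SemidirectProduct.left h
    simpa [← map_pow, mul_assoc] using this
  obtain ⟨g, rfl⟩ := mk_surjective u
  obtain ⟨k, hk⟩ := mk_surjective w.left
  have hact : ∃ g' : GL (Fin 2) L, pglGaloisAction K L w.right (mk g) = mk g' ∧
      traceSqDivDet g' = traceSqDivDet g := by
    by_cases hw : w.right = 1
    · exact ⟨g, by rw [hw, map_one]; rfl, rfl⟩
    · refine ⟨GeneralLinearGroup.map (galoisInvolution K L : L →+* L) g, ?_, ?_⟩
      · have : pglGaloisAction K L w.right = pglGaloisInvolution K L := if_neg hw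
        rw [this]
        rfl
      · rw [traceSqDivDet_map]
        exact algEquiv_traceSqDivDet_eq h5 (galoisInvolution K L) hu
  obtain ⟨g', hg', ht⟩ := hact
  rw [hg', ← hk, ← map_inv, ← map_mul, ← map_mul, ← map_pow] at hl
  have := traceSqDivDet_eq_of_mk_eq hl
  rw [traceSqDivDet_conj, ht] at this
  exact traceSqDivDet_sq_ne hu this.symm

end Semidirect

/-! ### Finite subgroups of the semidirect product -/

section Assembly

variable {K L : Type*} [Field K] [CharZero K] [Field L] [Algebra K L]
  [Algebra.IsQuadraticExtension K L]

theorem finiteJordanConstant_le_sixty (h5 : ∃ s : K, s ^ 2 = 5)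
    (G : Subgroup (PGL(2, L) ⋊[pglGaloisAction K L] Multiplicative (ZMod 2))) [Finite G] :
    finiteJordanConstant G ≤ 60 := by
  have : CharZero L := charZero_of_injective_algebraMap (algebraMap K L).injective
  let φ : G →* Multiplicative (ZMod 2) := SemidirectProduct.rightHom.comp G.subtype
  let N := φ.ker
  have hright : ∀ n : N, (n : G).1.right = 1 := fun n => n.2
  let ρ : N →* PGL(2, L) :=
    { toFun := fun n => (n : G).1.left
      map_one' := rfl
      map_mul' := fun a b => by
        simp [SemidirectProduct.mul_left, hright a] }
  have hρ : Function.Injective ρ := fun a b hab =>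
    Subtype.ext (Subtype.ext (SemidirectProduct.ext hab ((hright a).trans (hright b).symm)))
  have hidx : N.index ∣ 2 := by
    have h := Subgroup.card_subgroup_dvd_card φ.range
    rw [← Subgroup.index_ker] at h
    simpa using h
  have hidx2 : N.index ≤ 2 := Nat.le_of_dvd two_pos hidx
  have hcard := N.card_mul_index
  rcases exists_abelian_index_le_two_or_card_eq ρ hρ with ⟨A, hA, hAi⟩ | h | h | h
  · have hle : (A.map N.subtype).index ≤ 4 := by
      rw [Subgroup.index_map_subtype]
      exact Nat.mul_le_mul hAi hidx2
    refine (finiteJordanConstant_le_factorial_index (A.map N.subtype) ?_).trans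
      ((Nat.factorial_le hle).trans (by decide))
    rintro _ ⟨a, ha, rfl⟩ _ ⟨b, hb, rfl⟩
    rw [← map_mul, hA a ha b hb, map_mul]
  · exact finiteJordanConstant_le_card.trans (by rw [h] at hcard; omega)
  · exact finiteJordanConstant_le_card.trans (by rw [h] at hcard; omega)
  · rcases (Nat.dvd_prime Nat.prime_two).1 hidx with h1 | h2
    · exact finiteJordanConstant_le_card.trans (by rw [h, h1] at hcard; omega)
    · refine finiteJordanConstant_le_sixty_of_card_eq (by rw [← hcard, h, h2]) ?_
      intro x g hx he
      have hxN : x ∈ N := by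
        rw [MonoidHom.mem_ker, ← orderOf_eq_one_iff]
        have d5 : orderOf (φ x) ∣ 5 := hx ▸ orderOf_map_dvd φ x
        have d2 : orderOf (φ x) ∣ 2 := by simpa using orderOf_dvd_natCard (φ x)
        exact Nat.eq_one_of_dvd_coprimes (by norm_num) d5 d2
      have hu : orderOf (ρ ⟨x, hxN⟩) = 5 := by
        rw [orderOf_injective ρ hρ, Subgroup.orderOf_mk, hx]
      have hinl : SemidirectProduct.inl (ρ ⟨x, hxN⟩) = x.1 :=
        SemidirectProduct.ext rfl (hright ⟨x, hxN⟩).symm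
      refine conj_inl_ne_sq K L h5 g.1 hu ?_
      rw [hinl]
      exact congrArg Subtype.val he

end Assembly

theorem mainTheorem6 (K L : Type*) [Field K] [CharZero K] [Field L] [Algebra K L]
    [Algebra.IsQuadraticExtension K L]
    (h5 : ∃ s : K, s ^ 2 = 5)
    (hK : ¬ ∃ a b : K, a ^ 2 + b ^ 2 = -1) :
    jordanConstant (PGL(2, L) ⋊[pglGaloisAction K L] Multiplicative (ZMod 2)) ≤ 60 :=
  iSup₂_le fun G _ => by exact_mod_cast finiteJordanConstant_le_sixty h5 G
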